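/- Define $\mathrm{NE}(a,b,c)=0$ if $a=b=c$ and $\mathrm{NE}(a,b,c)=1$ otherwise, for $a,b,c\in\{0,1\}$. Put $\mathrm{NE}^0(x_1)=x_1$ and, for $d\ge 1$, $\mathrm{NE}^d(x_1,\dots,x_{3^d})=\mathrm{NE}\big(\mathrm{NE}^{d-1}(x_1,\dots,x_{3^{d-1}}),\ \mathrm{NE}^{d-1}(x_{3^{d-1}+1},\dots,x_{2\cdot 3^{d-1}}),\ \mathrm{NE}^{d-1}(x_{2\cdot 3^{d-1}+1},\dots,x_{3^d})\big)$. For $n=3^d$ and $x,y\in\{0,1\}^n$ let $\mathrm{RNE}(x,y)=\mathrm{NE}^d(x_1\wedge y_1,\dots,x_n\wedge y_n)$, and let $L_{NE}(n)=\{x\#^n y : x,y\in\{0,1\}^n,\ \mathrm{RNE}(x,y)=1\}$, a language over $\{0,1,\#\}$. A 2QCFA (two-way finite automaton with quantum and classical states) has a finite set $Q$ of orthonormal quantum basis states and a finite set $S$ of classical states, with disjoint sets of accepting and rejecting states. Its head starts on the left end-marker of the input (delimited by two end-markers) and never leaves the tape. In each step, depending on the classical state and the scanned symbol, it either applies a unitary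 operator to the quantum state and then changes the classical state and moves the head by $-1$, $0$ or $1$, or it makes a projective measurement of the quantum state, and the new classical state and the head move depend also on the outcome. It halts when it enters an accepting or a rejecting state. It is exact for a language $L$ if it accepts every word of $L$ with probability $1$ and rejects every other word over the input alphabet with probability $1$. It runs in time $T$ if, on every input word, every computation path of positive probability halts after at most $T$ steps. The space it uses is $\log_2|Q|+\log_2|S|$. Theorem 5. For every $n=3^d$, $d\ge 0$, there is an exact 2QCFA recognizing $L_{NE}(n)$ in some time $T(n)$ using some space $S(n)$, such that $T(n)\,S(n)=O(n^{1.87}\log n)$ as $n=3^d\to\infty$. -/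

import Mathlib

open Filter Asymptotics
open scoped ENNReal

/-- Symbols on the tape: the letters of the input alphabet and the two end-markers. -/
inductive TapeSymbol (A : Type) : Type
  | leftEnd : TapeSymbol A
  | letter (a : A) : TapeSymbol A
  | rightEnd : TapeSymbol A

/-- Head moves `-1`, `0`, `1`. -/
inductive HeadMove : Type
  | left
  | stay
  | right

/-- The new position of a head at position `p` after a move. -/
def HeadMove.apply : HeadMove → ℕ → ℕ
  | left, p => p - 1
  | stay, p => p
  | right, p => p + 1

/-- A projective measurement on the Hilbert space with orthonormal basis `Q`: mutually orthogonal
orthogonal projections that sum to the identity; the outcomes are the elements of `Fin m`. -/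
structure ProjMeasurement (Q : Type) [Fintype Q] : Type where
  m : ℕ
  P : Fin m → (EuclideanSpace ℂ Q →L[ℂ] EuclideanSpace ℂ Q)
  isProj : ∀ i, IsStarProjection (P i)
  orthogonal : ∀ i j, i ≠ j → P i * P j = 0
  complete : ∑ i, P i = 1

/-- What the automaton does in a given classical state on a given tape symbol: the value of the
quantum transition function together with the matching value of the classical one.
Either a unitary operator is applied and the classical part moves deterministically, or a
projective measurement is made and the classical move depends on the outcome. -/
inductive Instruction (Q S : Type) [Fintype Q] : Type
  | unitary (U : EuclideanSpace ℂ Q ≃ₗᵢ[ℂ] EuclideanSpace ℂ Q) (next : S × HeadMove) :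
      Instruction Q S
  | measure (μ : ProjMeasurement Q) (next : Fin μ.m → S × HeadMove) : Instruction Q S

/-- `I.CanMove h`: some branch of the instruction moves the head by `h`. -/
def Instruction.CanMove {Q S : Type} [Fintype Q] (h : HeadMove) : Instruction Q S → Prop
  | .unitary _ next => next.2 = h
  | .measure _ next => ∃ i, (next i).2 = h

/-- A two-way finite automaton with quantum and classical states (2QCFA) over the alphabet `A`.
The instructions of halting states are never used. -/
structure TwoQCFA (A : Type) : Type 1 where
  /-- the quantum basis states -/
  Q : Type
  /-- the classical states -/
  S : Type
  [fintypeQ : Fintype Q]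
  [decEqQ : DecidableEq Q]
  [fintypeS : Fintype S]
  [decEqS : DecidableEq S]
  q₀ : Q
  s₀ : S
  acc : Finset S
  rej : Finset S
  disjoint_acc_rej : Disjoint acc rej
  trans : S → TapeSymbol A → Instruction Q S
  /-- the head does not leave the tape on the left -/
  not_left : ∀ s, ¬ (trans s .leftEnd).CanMove .left
  /-- the head does not leave the tape on the right -/
  not_right : ∀ s, ¬ (trans s .rightEnd).CanMove .right

namespace TwoQCFA

attribute [instance] fintypeQ decEqQ fintypeS decEqS

variable {A : Type}

/-- The tape content: left end-marker at position `0`, the letters of `w` at positions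
`1, …, |w|`, right end-marker at position `|w| + 1` (later positions are never reached). -/
def tape (w : List A) (p : ℕ) : TapeSymbol A :=
  (TapeSymbol.leftEnd :: w.map TapeSymbol.letter).getD p TapeSymbol.rightEnd

/-- A configuration: classical state, head position, quantum state. -/
structure Config (M : TwoQCFA A) : Type where
  state : M.S
  pos : ℕ
  ψ : EuclideanSpace ℂ M.Q

/-- The initial configuration. -/
noncomputable def init (M : TwoQCFA A) : M.Config :=
  ⟨M.s₀, 0, EuclideanSpace.single M.q₀ 1⟩

/-- The configuration after the classical move `nx`, with new quantum state `φ`. -/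
def Config.move {M : TwoQCFA A} (c : M.Config) (nx : M.S × HeadMove)
    (φ : EuclideanSpace ℂ M.Q) : M.Config :=
  ⟨nx.1, nx.2.apply c.pos, φ⟩

/-- The normalized state `P_i ψ / ‖P_i ψ‖` after outcome `i` (meaningful if `P_i ψ ≠ 0`, that is,
if the outcome has positive probability). -/
noncomputable def postState {Q : Type} [Fintype Q] (μ : ProjMeasurement Q) (i : Fin μ.m)
    (ψ : EuclideanSpace ℂ Q) : EuclideanSpace ℂ Q :=
  ((‖μ.P i ψ‖⁻¹ : ℝ) : ℂ) • μ.P i ψ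

/-- The probability that `M` on input `w`, started in configuration `c`, within `t` steps enters
a state of `F`, where `F` is the set of accepting or the set of rejecting states.
Outcome `i` of a measurement has probability `‖P_i ψ‖²`. -/
noncomputable def haltProbWithin (M : TwoQCFA A) (w : List A) (F : Finset M.S) :
    ℕ → M.Config → ℝ≥0∞
  | 0, c => if c.state ∈ F then 1 else 0
  | t + 1, c =>
    if c.state ∈ F then 1
    else if c.state ∈ M.acc ∪ M.rej then 0
    else match M.trans c.state (tape w c.pos) with
      | .unitary U next => M.haltProbWithin w F t (c.move next (U c.ψ))
      | .measure μ next =>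
          ∑ i, ‖μ.P i c.ψ‖ₑ ^ 2 * M.haltProbWithin w F t (c.move (next i) (postState μ i c.ψ))

/-- The probability that `M` accepts `w`. -/
noncomputable def acceptProb (M : TwoQCFA A) (w : List A) : ℝ≥0∞ :=
  ⨆ t, M.haltProbWithin w M.acc t M.init

/-- The probability that `M` rejects `w`. -/
noncomputable def rejectProb (M : TwoQCFA A) (w : List A) : ℝ≥0∞ :=
  ⨆ t, M.haltProbWithin w M.rej t M.init

/-- `M` recognizes `L` with error `ε`. -/
def RecognizesWithError (M : TwoQCFA A) (L : Language A) (ε : ℝ≥0∞) : Prop :=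
  (∀ w ∈ L, 1 - ε ≤ M.acceptProb w) ∧ (∀ w ∉ L, 1 - ε ≤ M.rejectProb w)

/-- `M` is an exact automaton for `L`: it recognizes `L` with error `0`. -/
def RecognizesExactly (M : TwoQCFA A) (L : Language A) : Prop :=
  M.RecognizesWithError L 0

/-- Every computation path of `M` on input `w` that starts in `c` and has positive probability
halts after at most `t` steps. -/
def HaltsWithin (M : TwoQCFA A) (w : List A) : ℕ → M.Config → Prop
  | 0, c => c.state ∈ M.acc ∪ M.rej
  | t + 1, c =>
    c.state ∈ M.acc ∪ M.rej ∨
      match M.trans c.state (tape w c.pos) with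
      | .unitary U next => M.HaltsWithin w t (c.move next (U c.ψ))
      | .measure μ next =>
          ∀ i, μ.P i c.ψ ≠ 0 → M.HaltsWithin w t (c.move (next i) (postState μ i c.ψ))

/-- `M` runs in time `T`: on every input word, every computation path halts within `T` steps. -/
def RunsInTime (M : TwoQCFA A) (T : ℕ) : Prop :=
  ∀ w : List A, M.HaltsWithin w T M.init

/-- The space used by `M`, in (qu)bits: the logarithm of the number of quantum basis states plus
the logarithm of the number of classical states. -/
noncomputable def space (M : TwoQCFA A) : ℝ :=
  Real.logb 2 (Fintype.card M.Q) + Real.logb 2 (Fintype.card M.S)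

end TwoQCFA

/-- `NE(a, b, c) = 0` if `a = b = c`, and `1` otherwise. -/
def NE (a b c : Bool) : Bool := !(a == b && b == c)

/-- The iterated function `NE^d` on `3^d` bits. -/
def NEiter : (d : ℕ) → (Fin (3 ^ d) → Bool) → Bool
  | 0, x => x ⟨0, by simp⟩
  | d + 1, x =>
    NE (NEiter d fun i => x ⟨i, by have := i.2; rw [pow_succ]; omega⟩)
      (NEiter d fun i => x ⟨3 ^ d + i, by have := i.2; rw [pow_succ]; omega⟩)
      (NEiter d fun i => x ⟨2 * 3 ^ d + i, by have := i.2; rw [pow_succ]; omega⟩)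

/-- `RNE(x, y) = NE^d(x ∧ y)`. -/
def RNE (d : ℕ) (x y : Fin (3 ^ d) → Bool) : Bool :=
  NEiter d fun i => x i && y i

/-- The input alphabet `{0, 1, #}`. -/
inductive Letter : Type
  | zero
  | one
  | hash

/-- A bit as a letter. -/
def Letter.ofBool : Bool → Letter
  | false => zero
  | true => one

/-- The word `x_1 … x_n`. -/
def bitWord {n : ℕ} (x : Fin n → Bool) : List Letter :=
  (List.ofFn x).map Letter.ofBool

/-- The language `L_NE(n)` for `n = 3^d`. -/
def LNE (d : ℕ) : Language Letter :=
  {w | ∃ x y : Fin (3 ^ d) → Bool, RNE d x y = true ∧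
    w = bitWord x ++ List.replicate (3 ^ d) Letter.hash ++ bitWord y}

/-! Ambainis' algorithm is run by an automaton that answers each query by a sweep over the tape. For
a query program with unitary `A` and a unit vector `ψ`, the invariant `ComputesNE` says that `A ψ =
ψ` if the function is 0 and `⟨ψ, A ψ⟩ = p` if it is 1. At level 0 a single phase query gives `p =
-1`. Three operations preserve the invariant: `succ` goes up one level and turns `u = 1 - p` into `4
u² / 9`; `double` puts a reflection in `ψ` between `A` and its inverse and turns `p` into `2 p² -
1`; `raise` dilutes `A` with the identity and increases `p` at will, up to 1. The first two double
`L + 1`, where `L` bounds the length; the third only doubles the dimension.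

Repeated use of `succ` drives `p` towards 1, so `p` is raised to a convenient value near 0 and
doubled back to a value near -1. Eight levels with three doublings return exactly to -1: `L + 1`
grows by `2 ^ 11` while `n` grows by `3 ^ 8`, and `2 ^ 11 < 3 ^ (8 * 0.87)`, whence `O(n ^ 0.87)`
instructions. A last `raise` to `p = 0` makes the two answers orthogonal, so that one measurement
separates them without error.

A query has to apply the sign of `x i && y i`, but the two bits lie `2 n` cells apart. A work qubit
carries `x i` to `y i` on the way right and is erased on the way back. Since the classical state
records the head position, the sweep also checks the form of the word. Each instruction takes `O(n)`
steps, hence time `O(n ^ 1.87)`; the numbers of states are polynomial in `n`, hence space `O(log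
n)`. -/

/-! ### Query programs -/

section BlockSpaces

/-- The vector of the direct sum of copies of a space that has the given components. -/
noncomputable def blocks {ι Q : Type} (φ : ι → EuclideanSpace ℂ Q) :
    EuclideanSpace ℂ (Σ _ : ι, Q) :=
  WithLp.toLp 2 fun iq => φ iq.1 iq.2

@[simp] theorem blocks_apply {ι Q : Type} (φ : ι → EuclideanSpace ℂ Q) (i : ι) (q : Q) :
    blocks φ ⟨i, q⟩ = φ i q := rfl

variable {ι Q : Type} [Fintype ι] [Fintype Q]

/-- The unitary that negates the coordinates in `s`. -/
noncomputable def phaseFlip (s : Q → Bool) : EuclideanSpace ℂ Q ≃ₗᵢ[ℂ] EuclideanSpace ℂ Q :=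
  LinearIsometryEquiv.piLpCongrRight 2
    fun q => if s q then LinearIsometryEquiv.neg ℂ else LinearIsometryEquiv.refl ℂ ℂ

theorem phaseFlip_apply (s : Q → Bool) (v : EuclideanSpace ℂ Q) (q : Q) :
    phaseFlip s v q = if s q then -v q else v q := by
  by_cases h : s q <;> simp [phaseFlip, h]

/-- Signs square to one, so a query is its own inverse and inverting a program costs no new kind of
query. -/
theorem phaseFlip_symm (s : Q → Bool) : (phaseFlip s).symm = phaseFlip s := by
  ext v q
  have h := congrArg (fun u : EuclideanSpace ℂ Q => u q)
    ((phaseFlip s).apply_symm_apply v)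
  simp only [phaseFlip_apply] at h ⊢
  by_cases hq : s q
  · simp only [hq, if_true] at h ⊢
    rw [← h, neg_neg]
  · simpa [hq] using h

theorem inner_blocks (φ χ : ι → EuclideanSpace ℂ Q) :
    inner ℂ (blocks φ) (blocks χ) = ∑ i, inner ℂ (φ i) (χ i) := by
  simp [PiLp.inner_apply, Fintype.sum_sigma]

theorem norm_blocks_eq_one {φ : ι → EuclideanSpace ℂ Q}
    (h : ∑ i, inner ℂ (φ i) (φ i) = (1 : ℂ)) : ‖blocks φ‖ = 1 := by
  rw [← inner_blocks, inner_self_eq_norm_sq_to_K] at h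
  have h' : ‖blocks φ‖ ^ 2 = 1 := by
    rw [← Complex.ofReal_inj]
    push_cast
    exact h
  exact (pow_eq_one_iff_of_nonneg (norm_nonneg _) two_ne_zero).1 h'

/-- The block diagonal unitary with the given blocks. -/
noncomputable def blockDiag (U : ι → EuclideanSpace ℂ Q ≃ₗᵢ[ℂ] EuclideanSpace ℂ Q) :
    EuclideanSpace ℂ (Σ _ : ι, Q) ≃ₗᵢ[ℂ] EuclideanSpace ℂ (Σ _ : ι, Q) :=
  ((LinearIsometryEquiv.piLpCurry ℂ 2 fun (_ : ι) (_ : Q) => ℂ).trans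
    (LinearIsometryEquiv.piLpCongrRight 2 U)).trans
    (LinearIsometryEquiv.piLpCurry ℂ 2 fun (_ : ι) (_ : Q) => ℂ).symm

theorem blockDiag_blocks (U : ι → EuclideanSpace ℂ Q ≃ₗᵢ[ℂ] EuclideanSpace ℂ Q)
    (φ : ι → EuclideanSpace ℂ Q) : blockDiag U (blocks φ) = blocks fun i => U i (φ i) := by
  ext ⟨i, q⟩
  rfl

end BlockSpaces

section Programs

/-- A query program: `some U` is a unitary operator, `none` is a query. -/
abbrev QProg (Q : Type) [Fintype Q] : Type :=
  List (Option (EuclideanSpace ℂ Q ≃ₗᵢ[ℂ] EuclideanSpace ℂ Q))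

variable {ι Q X Y : Type} [Fintype ι] [Fintype Q]

/-- The value of the variable queried by the basis state `q`, if any. -/
def oracleBit (loc : Q → Option X) (z : X → Bool) (q : Q) : Bool :=
  (loc q).elim false z

/-- The unitary operator of one instruction of a query program. -/
noncomputable def opEval (loc : Q → Option X) (z : X → Bool) :
    Option (EuclideanSpace ℂ Q ≃ₗᵢ[ℂ] EuclideanSpace ℂ Q) →
      EuclideanSpace ℂ Q ≃ₗᵢ[ℂ] EuclideanSpace ℂ Q
  | some U => U
  | none => phaseFlip (oracleBit loc z)

/-- The unitary operator of a query program. -/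
noncomputable def progEval (loc : Q → Option X) (z : X → Bool) :
    QProg Q → EuclideanSpace ℂ Q ≃ₗᵢ[ℂ] EuclideanSpace ℂ Q
  | [] => LinearIsometryEquiv.refl ℂ _
  | o :: l => (opEval loc z o).trans (progEval loc z l)

theorem progEval_append (loc : Q → Option X) (z : X → Bool) (l m : QProg Q)
    (v : EuclideanSpace ℂ Q) :
    progEval loc z (l ++ m) v = progEval loc z m (progEval loc z l v) := by
  induction l generalizing v with
  | nil => rfl
  | cons o l ih => exact ih _

/-- The inverse program. -/
noncomputable def progInv (l : QProg Q) : QProg Q :=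
  (l.map (Option.map LinearIsometryEquiv.symm)).reverse

theorem progInv_length (l : QProg Q) : (progInv l).length = l.length := by
  simp [progInv]

theorem progEval_inv (loc : Q → Option X) (z : X → Bool) (l : QProg Q)
    (v : EuclideanSpace ℂ Q) :
    progEval loc z (progInv l) v = (progEval loc z l).symm v := by
  induction l generalizing v with
  | nil => rfl
  | cons o l ih =>
    have h : progInv (o :: l) = progInv l ++ [o.map LinearIsometryEquiv.symm] := by
      simp [progInv]
    rw [h, progEval_append, ih]
    have h2 : opEval loc z (o.map LinearIsometryEquiv.symm) = (opEval loc z o).symm := by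
      cases o with
      | none => exact (phaseFlip_symm _).symm
      | some U => rfl
    change opEval loc z (o.map LinearIsometryEquiv.symm) _ = _
    rw [h2]
    rfl

/-- The program that runs `l` on all the blocks in `act`. -/
noncomputable def progBlocks (act : ι → Bool) (l : QProg Q) : QProg (Σ _ : ι, Q) :=
  l.map (Option.map fun U => blockDiag fun i => if act i then U else LinearIsometryEquiv.refl ℂ _)

/-- The queries of `progBlocks`, where block `i` queries the variables `f i`. -/
def locBlocks (act : ι → Bool) (f : ι → X → Y) (loc : Q → Option X) (iq : Σ _ : ι, Q) : Option Y :=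
  if act iq.1 then (loc iq.2).map (f iq.1) else none

/-- All blocks run in superposition, so the length of `l` is paid once, however many blocks there
are. -/
theorem progEval_blocks (act : ι → Bool) (f : ι → X → Y) (loc : Q → Option X) (z : Y → Bool)
    (l : QProg Q) (φ : ι → EuclideanSpace ℂ Q) :
    progEval (locBlocks act f loc) z (progBlocks act l) (blocks φ) =
      blocks fun i => if act i then progEval loc (fun x => z (f i x)) l (φ i) else φ i := by
  induction l generalizing φ with
  | nil =>
    change blocks φ = _
    congr 1
    funext i
    split_ifs <;> rfl
  | cons o l ih =>
    have key : opEval (locBlocks act f loc) z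
        (o.map fun U => blockDiag fun i => if act i then U else LinearIsometryEquiv.refl ℂ _)
        (blocks φ) =
        blocks fun i => if act i then opEval loc (fun x => z (f i x)) o (φ i) else φ i := by
      cases o with
      | some U =>
        change blockDiag _ (blocks φ) = _
        rw [blockDiag_blocks]
        congr 1
        funext i
        split_ifs <;> rfl
      | none =>
        ext ⟨i, q⟩
        change phaseFlip _ _ _ = _
        rw [phaseFlip_apply]
        by_cases hi : act i
        · have : oracleBit (locBlocks act f loc) z ⟨i, q⟩ =
              oracleBit loc (fun x => z (f i x)) q := by
            simp only [oracleBit, locBlocks, hi, if_true]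
            cases loc q <;> rfl
          simp [this, hi, opEval, phaseFlip_apply]
        · have : oracleBit (locBlocks act f loc) z ⟨i, q⟩ = false := by
            simp [oracleBit, locBlocks, hi]
          simp [this, hi]
    change progEval _ _ (progBlocks act l) (opEval _ _ _ (blocks φ)) = _
    rw [key, ih]
    congr 1
    funext i
    by_cases hi : act i <;> simp [hi, progEval]

end Programs

/-! ### Ambainis' algorithm -/

/-- There is a query program on at most `m` basis states with at most `L` instructions that fixes
a unit vector if `NE^d = 0`, and maps it to a vector with component `p` along it if `NE^d = 1`. -/
def ComputesNE (d : ℕ) (p : ℝ) (L m : ℕ) : Prop :=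
  ∃ (Q : Type) (_ : Fintype Q) (_ : DecidableEq Q) (loc : Q → Option (Fin (3 ^ d)))
    (l : QProg Q) (ψ : EuclideanSpace ℂ Q),
    Fintype.card Q ≤ m ∧ l.length ≤ L ∧ ‖ψ‖ = 1 ∧ ∀ z : Fin (3 ^ d) → Bool,
      (NEiter d z = false → progEval loc z l ψ = ψ) ∧
      (NEiter d z = true → inner ℂ ψ (progEval loc z l ψ) = (p : ℂ))

namespace ComputesNE

variable {d L m : ℕ} {p : ℝ}

theorem zero : ComputesNE 0 (-1) 1 1 := by
  refine ⟨Unit, inferInstance, inferInstance, fun _ => some ⟨0, by simp⟩, [none],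
    EuclideanSpace.single () 1, by simp, by simp, by simp, fun z => ?_⟩
  have key : ∀ b, NEiter 0 z = b →
      progEval (fun _ : Unit => some (⟨0, by simp⟩ : Fin (3 ^ 0))) z [none]
        (EuclideanSpace.single () (1 : ℂ)) =
      (if b then (-1 : ℂ) else 1) • EuclideanSpace.single () (1 : ℂ) := by
    intro b hb
    ext q
    change phaseFlip _ _ _ = _
    rw [phaseFlip_apply]
    have hz : oracleBit (fun _ : Unit => some (⟨0, by simp⟩ : Fin (3 ^ 0))) z q = b := hb
    rw [hz]
    cases b <;> simp
  refine ⟨fun h => ?_, fun h => ?_⟩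
  · simpa using key _ h
  · rw [key _ h]
    simp

theorem mono {L' m' : ℕ} (h : ComputesNE d p L m) (hL : L ≤ L') (hm : m ≤ m') :
    ComputesNE d p L' m' := by
  obtain ⟨Q, i1, i2, loc, l, ψ, h1, h2, h3⟩ := h
  exact ⟨Q, i1, i2, loc, l, ψ, h1.trans hm, h2.trans hL, h3⟩

/-- Start in a superposition of two copies of `ψ` and run the program on one of them only; the
overlap becomes a weighted mean of `p` and 1. -/
theorem raise (h : ComputesNE d p L m) {p' : ℝ} (hp : p < 1) (h1 : p ≤ p') (h2 : p' ≤ 1) :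
    ComputesNE d p' L (2 * m) := by
  -- The weight `a` of the active copy solves `a * p + (1 - a) = p'`.
  obtain ⟨Q, _, _, loc, l, ψ, hQ, hl, hψ, hA⟩ := h
  set a : ℝ := (1 - p') / (1 - p) with ha
  have hp1 : 0 < 1 - p := by linarith
  have ha0 : 0 ≤ a := div_nonneg (by linarith) hp1.le
  have ha1 : a ≤ 1 := by rw [ha, div_le_one hp1]; linarith
  set c : Bool → ℂ := fun b => if b then ((Real.sqrt a : ℝ) : ℂ) else ((Real.sqrt (1 - a) : ℝ) : ℂ)
    with hc
  have hct : (starRingEnd ℂ) (c true) * c true = (a : ℂ) := by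
    simp only [hc, if_true, Complex.conj_ofReal]
    rw [← Complex.ofReal_mul, Real.mul_self_sqrt ha0]
  have hcf : (starRingEnd ℂ) (c false) * c false = ((1 - a : ℝ) : ℂ) := by
    simp only [hc, Bool.false_eq_true, if_false, Complex.conj_ofReal]
    rw [← Complex.ofReal_mul, Real.mul_self_sqrt (by linarith)]
  have hψψ : inner ℂ ψ ψ = (1 : ℂ) := by
    rw [inner_self_eq_norm_sq_to_K, hψ]; simp
  refine ⟨Σ _ : Bool, Q, inferInstance, inferInstance, locBlocks id (fun _ => id) loc,
    progBlocks id l, blocks fun b => c b • ψ, ?_, ?_, ?_, fun z => ⟨fun hz => ?_, fun hz => ?_⟩⟩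
  · simp [Fintype.card_sigma]; omega
  · simpa [progBlocks] using hl
  · apply norm_blocks_eq_one
    simp only [Fintype.sum_bool, inner_smul_left, inner_smul_right, hψψ]
    push_cast at hcf
    linear_combination hct + hcf
  · rw [progEval_blocks]
    congr 1
    funext b
    cases b
    · simp
    · simp only [id, if_true, map_smul]
      rw [(hA z).1 hz]
  · rw [progEval_blocks, inner_blocks]
    simp only [Fintype.sum_bool, id, if_true, map_smul, inner_smul_left, inner_smul_right,
      Bool.false_eq_true, if_false, hψψ, ← mul_assoc, hct, hcf, mul_one]
    rw [(hA z).2 hz]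
    rw [← Complex.ofReal_mul, ← Complex.ofReal_add]
    congr 1
    rw [ha]; field_simp; ring

theorem reflection_unit {V : Type*} [NormedAddCommGroup V] [InnerProductSpace ℂ V] {ψ : V}
    (hψ : ‖ψ‖ = 1) (v : V) :
    (Submodule.span ℂ {ψ}).reflection v = (2 * inner ℂ ψ v) • ψ - v := by
  rw [Submodule.reflection_apply, Submodule.starProjection_unit_singleton ℂ hψ, mul_smul,
    two_smul, two_smul]

/-- With `A` the program and `R` the reflection in `ψ`, the overlap of `ψ` with `A⁻¹ R A ψ` is `⟨A
ψ, R A ψ⟩ = 2 |⟨ψ, A ψ⟩|² - 1`. -/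
theorem double (h : ComputesNE d p L m) : ComputesNE d (2 * p ^ 2 - 1) (2 * L + 1) m := by
  obtain ⟨Q, _, _, loc, l, ψ, hQ, hl, hψ, hA⟩ := h
  refine ⟨Q, inferInstance, inferInstance, loc,
    l ++ some (Submodule.span ℂ {ψ}).reflection :: progInv l, ψ, hQ, ?_, hψ,
    fun z => ⟨fun hz => ?_, fun hz => ?_⟩⟩
  · simp [progInv_length]; omega
  · rw [progEval_append, (hA z).1 hz]
    change progEval loc z (progInv l) ((Submodule.span ℂ {ψ}).reflection ψ) = ψ
    rw [Submodule.reflection_mem_subspace_eq_self (Submodule.mem_span_singleton_self ψ),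
      progEval_inv, LinearIsometryEquiv.symm_apply_eq, (hA z).1 hz]
  · rw [progEval_append]
    change inner ℂ ψ (progEval loc z (progInv l)
      ((Submodule.span ℂ {ψ}).reflection (progEval loc z l ψ))) = _
    rw [progEval_inv, ← LinearIsometryEquiv.inner_map_map (progEval loc z l),
      LinearIsometryEquiv.apply_symm_apply, reflection_unit hψ, inner_sub_right, inner_smul_right,
      ← inner_conj_symm _ ψ, (hA z).2 hz, LinearIsometryEquiv.inner_map_map,
      inner_self_eq_norm_sq_to_K, hψ]
    simp
    ring

/-- The position of variable `j` of the `i`-th of the three blocks of variables. -/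
def blockVar (d : ℕ) (i : Fin 3) (j : Fin (3 ^ d)) : Fin (3 ^ (d + 1)) :=
  ⟨i * 3 ^ d + j, by
    have h1 := j.2
    have h2 : (i : ℕ) * 3 ^ d ≤ 2 * 3 ^ d := Nat.mul_le_mul_right _ (by omega)
    rw [pow_succ]; omega⟩

theorem NEiter_succ (z : Fin (3 ^ (d + 1)) → Bool) :
    NEiter (d + 1) z = NE (NEiter d fun j => z (blockVar d 0 j))
      (NEiter d fun j => z (blockVar d 1 j)) (NEiter d fun j => z (blockVar d 2 j)) := by
  simp [NEiter, blockVar]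

/-- Run the program on three blocks, apply `R`, and undo the program. `R` only sees how far the
three overlaps `b i` deviate from their mean: equal overlaps leave the state fixed, and otherwise
the new overlap is `1 - 2 Var b`. For a two-to-one split between 1 and `p` the variance is `2 (1 -
p)² / 9`. -/
theorem succ (h : ComputesNE d p L m) :
    ComputesNE (d + 1) (1 - 4 * (1 - p) ^ 2 / 9) (2 * L + 1) (3 * m) := by
  obtain ⟨Q, _, _, loc, l, ψ, hQ, hl, hψ, hA⟩ := h
  set s : ℝ := (Real.sqrt 3)⁻¹ with hs
  have hss : (s : ℂ) * s = 1 / 3 := by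
    rw [← Complex.ofReal_mul, hs, ← mul_inv, Real.mul_self_sqrt (by norm_num)]
    norm_num
  have hψψ : inner ℂ ψ ψ = (1 : ℂ) := by
    rw [inner_self_eq_norm_sq_to_K, hψ]; simp
  set Ψ : EuclideanSpace ℂ (Σ _ : Fin 3, Q) := blocks fun _ => (s : ℂ) • ψ with hΨ
  have hΨ1 : ‖Ψ‖ = 1 := by
    apply norm_blocks_eq_one
    simp only [Fin.sum_univ_three, inner_smul_left, inner_smul_right, hψψ, Complex.conj_ofReal,
      mul_one, hss]
    norm_num
  set R := (Submodule.span ℂ {Ψ}).reflection.trans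
    (blockDiag fun _ => (Submodule.span ℂ {ψ}).reflection) with hR
  set loc' := locBlocks (fun _ : Fin 3 => true) (blockVar d) loc
  set l' := progBlocks (fun _ : Fin 3 => true) l
  have heval : ∀ z, progEval loc' z l' Ψ =
      blocks fun i => (s : ℂ) • progEval loc (fun j => z (blockVar d i j)) l ψ := by
    intro z
    rw [hΨ, progEval_blocks]
    simp only [if_true, map_smul]
  -- The reflection in `Ψ` negates `χ i` up to a multiple of `ψ`; the blockwise reflection in `ψ`
  -- restores the sign, so only the `ψ`-component is changed.
  have hRφ : ∀ (χ : Fin 3 → EuclideanSpace ℂ Q) (b : Fin 3 → ℂ),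
      (∀ i, inner ℂ ψ (χ i) = b i) → R (blocks fun i => (s : ℂ) • χ i) =
      blocks fun i => (s : ℂ) • ((2 * ((b 0 + b 1 + b 2) / 3) - 2 * b i) • ψ + χ i) := by
    intro χ b hb
    have h1 : inner ℂ Ψ (blocks fun i => (s : ℂ) • χ i) = (b 0 + b 1 + b 2) / 3 := by
      simp only [hΨ, inner_blocks, Fin.sum_univ_three, inner_smul_left, inner_smul_right, hb,
        Complex.conj_ofReal, ← mul_assoc, hss]
      ring
    have h2 : (Submodule.span ℂ {Ψ}).reflection (blocks fun i => (s : ℂ) • χ i) =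
        blocks fun i => (s : ℂ) • ((2 * ((b 0 + b 1 + b 2) / 3)) • ψ - χ i) := by
      rw [reflection_unit hΨ1, h1]
      ext ⟨i, q⟩
      simp [hΨ]
      ring
    rw [hR, LinearIsometryEquiv.trans_apply, h2, blockDiag_blocks]
    congr 1
    funext i
    rw [map_smul, reflection_unit hψ, inner_sub_right, inner_smul_right, hψψ, hb]
    congr 1
    module
  have hb : ∀ z : Fin (3 ^ d) → Bool, inner ℂ ψ (progEval loc z l ψ) =
      if NEiter d z then (p : ℂ) else 1 := by
    intro z
    cases hz : NEiter d z
    · rw [(hA z).1 hz, hψψ]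
      rfl
    · simpa using (hA z).2 hz
  refine ⟨Σ _ : Fin 3, Q, inferInstance, inferInstance, loc', l' ++ some R :: progInv l', Ψ,
    ?_, ?_, hΨ1, fun z => ?_⟩
  · simp [Fintype.card_sigma]; omega
  · simp [progInv_length, l', progBlocks]; omega
  set f : Fin 3 → Bool := fun i => NEiter d fun j => z (blockVar d i j) with hf
  set χ : Fin 3 → EuclideanSpace ℂ Q := fun i => progEval loc (fun j => z (blockVar d i j)) l ψ
    with hχ
  have hRz := hRφ χ (fun i => if f i then (p : ℂ) else 1) fun i => hb _
  have hfull : progEval loc' z (l' ++ some R :: progInv l') Ψ =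
      (progEval loc' z l').symm (R (blocks fun i => (s : ℂ) • χ i)) := by
    rw [progEval_append, heval]
    exact progEval_inv _ _ _ _
  have hNE := NEiter_succ z
  change _ = NE (f 0) (f 1) (f 2) at hNE
  rw [hfull, hNE, hRz]
  refine ⟨fun hz => ?_, fun hz => ?_⟩
  · rw [LinearIsometryEquiv.symm_apply_eq, heval]
    congr 1
    funext i
    have hall : ∀ i, f i = f 0 := by
      simp only [NE, Bool.not_eq_false', Bool.and_eq_true, beq_iff_eq] at hz
      intro i
      fin_cases i
      · rfl
      · exact hz.1.symm
      · exact (hz.1.trans hz.2).symm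
    simp only [hall]
    rw [show (2 * (((if f 0 then (p : ℂ) else 1) + (if f 0 then (p : ℂ) else 1) +
      (if f 0 then (p : ℂ) else 1)) / 3) - 2 * (if f 0 then (p : ℂ) else 1)) = 0 by ring,
      zero_smul, zero_add]
  · rw [← LinearIsometryEquiv.inner_map_map (progEval loc' z l'),
      LinearIsometryEquiv.apply_symm_apply, heval, inner_blocks]
    have hχψ : ∀ i, inner ℂ (χ i) ψ = if f i then (p : ℂ) else 1 := by
      intro i
      rw [← inner_conj_symm, hb]
      simp only [hf]
      split_ifs <;> simp
    have hχχ : ∀ i, inner ℂ (χ i) (χ i) = (1 : ℂ) := by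
      intro i
      rw [hχ, LinearIsometryEquiv.inner_map_map, hψψ]
    have hterm : ∀ i (c : ℂ), inner ℂ ((s : ℂ) • χ i) ((s : ℂ) • (c • ψ + χ i)) =
        1 / 3 * (c * (if f i then (p : ℂ) else 1) + 1) := by
      intro i c
      rw [inner_smul_left, inner_smul_right, inner_add_right, inner_smul_right, hχψ, hχχ,
        Complex.conj_ofReal, ← mul_assoc, hss]
    change ∑ i, inner ℂ ((s : ℂ) • χ i) _ = _
    simp only [hterm, Fin.sum_univ_three]
    push_cast
    revert hz
    generalize f 0 = a0
    generalize f 1 = a1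
    generalize f 2 = a2
    intro hz
    -- The mixed assignments all have the same variance.
    cases a0 <;> cases a1 <;> cases a2 <;> simp [NE] at hz ⊢ <;> ring

/-! ### Cost of returning to overlap -1 -/

theorem succ_of_neg_one (h : ComputesNE d (-1) L m) :
    ComputesNE (d + 1) (-1) (4 * L + 3) (6 * m) := by
  have h1 := (h.succ.raise (p' := 0) (by norm_num) (by norm_num) (by norm_num)).double
  norm_num at h1
  exact h1.mono (by omega) (by omega)

/-- Three levels take -1 to about 0.123, raised to 1/8 and doubled to -31/32; three more give about
0.227, raised to 1/4 and doubled to -7/8; two more give about -0.085, raised to 0 and doubled to -1.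
These eleven uses of `succ` and `double` give the factor `2 ^ 11`. -/
theorem add_eight_of_neg_one (h : ComputesNE d (-1) L m) :
    ComputesNE (d + 8) (-1) (2048 * L + 2047) (6 ^ 8 * m) := by
  have h1 := (h.succ.succ.succ.raise (p' := 1 / 8) (by norm_num) (by norm_num) (by norm_num)).double
  have h2 := (h1.succ.succ.succ.raise (p' := 1 / 4) (by norm_num) (by norm_num)
    (by norm_num)).double
  have h3 := (h2.succ.succ.raise (p' := 0) (by norm_num) (by norm_num) (by norm_num)).double
  rw [show (2 * (0 : ℝ) ^ 2 - 1) = -1 by norm_num] at h3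
  exact h3.mono (by omega) (by omega)

/-- The remaining `r` levels use the costlier single step, at a factor 4 each; with `r < 8` this is
a constant. -/
theorem exists_neg_one (k r : ℕ) :
    ComputesNE (8 * k + r) (-1) (2 * 2048 ^ k * 4 ^ r - 1) (6 ^ (8 * k + r)) := by
  induction r with
  | zero =>
    induction k with
    | zero => exact zero
    | succ k ih =>
      have hpos : 0 < 2048 ^ k := by positivity
      refine ih.add_eight_of_neg_one.mono ?_ ?_
      · simp only [pow_succ, pow_zero]; omega
      · exact (by ring : 6 ^ 8 * 6 ^ (8 * k + 0) = 6 ^ (8 * (k + 1) + 0)).le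
  | succ r ih =>
    have hpos : 0 < 2048 ^ k * 4 ^ r := by positivity
    refine ih.succ_of_neg_one.mono ?_ ?_
    · rw [pow_succ, ← mul_assoc, mul_assoc 2]; omega
    · rw [← add_assoc, pow_succ, mul_comm]

end ComputesNE

/-! ### Deterministic stretches of a computation -/

namespace TwoQCFA

variable {A : Type} {M : TwoQCFA A} {w : List A}

/-- From the configuration `c`, the computation leads in `k` steps to `c'`. -/
structure Reaches (M : TwoQCFA A) (w : List A) (k : ℕ) (c c' : M.Config) : Prop where
  halts : ∀ t, M.HaltsWithin w t c' → M.HaltsWithin w (t + k) c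
  prob : ∀ F ⊆ M.acc ∪ M.rej, ∀ t, M.haltProbWithin w F t c' = M.haltProbWithin w F (t + k) c

theorem Reaches.rfl {c : M.Config} : M.Reaches w 0 c c :=
  ⟨fun _ h => h, fun _ _ _ => _root_.rfl⟩

theorem Reaches.trans {c c' c'' : M.Config} {k k' : ℕ} (h : M.Reaches w k c c')
    (h' : M.Reaches w k' c' c'') : M.Reaches w (k + k') c c'' := by
  constructor
  · intro t ht
    have := h.halts _ (h'.halts t ht)
    rwa [add_assoc, add_comm k'] at this
  · intro F hF t
    rw [h'.prob F hF, h.prob F hF, add_assoc, add_comm k']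

theorem Reaches.unitary {c : M.Config} (hc : c.state ∉ M.acc ∪ M.rej)
    {U : EuclideanSpace ℂ M.Q ≃ₗᵢ[ℂ] EuclideanSpace ℂ M.Q} {next : M.S × HeadMove}
    (h : M.trans c.state (tape w c.pos) = .unitary U next) :
    M.Reaches w 1 c (c.move next (U c.ψ)) := by
  constructor
  · intro t ht
    simp only [HaltsWithin, h]
    exact Or.inr ht
  · intro F hF t
    simp only [haltProbWithin, h]
    rw [if_neg fun hh => hc (hF hh), if_neg hc]

theorem haltsWithin_of_mem {c : M.Config} (hc : c.state ∈ M.acc ∪ M.rej) (t : ℕ) :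
    M.HaltsWithin w t c := by
  cases t with
  | zero => exact hc
  | succ t => exact Or.inl hc

theorem haltProbWithin_of_mem {c : M.Config} {F : Finset M.S} (hc : c.state ∈ F) (t : ℕ) :
    M.haltProbWithin w F t c = 1 := by
  cases t <;> simp [haltProbWithin, hc]

end TwoQCFA

/-- The measurement that tests membership in a subspace. -/
noncomputable def subspaceMeasurement {Q : Type} [Fintype Q]
    (K : Submodule ℂ (EuclideanSpace ℂ Q)) : ProjMeasurement Q where
  m := 2
  P := ![K.starProjection, Kᗮ.starProjection]
  isProj i := by
    fin_cases i
    · exact isStarProjection_starProjection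
    · exact isStarProjection_starProjection
  orthogonal i j hij := by
    fin_cases i <;> fin_cases j
    · exact absurd rfl hij
    · ext1 v
      change K.starProjection (Kᗮ.starProjection v) = 0
      exact (Submodule.starProjection_apply_eq_zero_iff K).2 (Submodule.starProjection_apply_mem _ v)
    · ext1 v
      change Kᗮ.starProjection (K.starProjection v) = 0
      exact K.starProjection_orthogonal_apply_eq_zero (Submodule.starProjection_apply_mem _ v)
    · exact absurd rfl hij
  complete := by
    rw [Fin.sum_univ_two]
    change K.starProjection + Kᗮ.starProjection = 1
    rw [Submodule.starProjection_orthogonal']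
    abel

/-! ### Simulation of a query by a sweep over the tape -/

section Sweep

/-- The state `∑ (-1)^{π q} φ_q |β q, q⟩`. -/
noncomputable def workState {Q : Type} (β π : Q → Bool) (φ : EuclideanSpace ℂ Q) :
    EuclideanSpace ℂ (Σ _ : Bool, Q) :=
  WithLp.toLp 2 fun bq => if bq.1 = β bq.2 then (if π bq.2 then -φ bq.2 else φ bq.2) else 0

theorem workState_false {Q : Type} (φ : EuclideanSpace ℂ Q) :
    workState (fun _ => false) (fun _ => false) φ = blocks fun b => if b then 0 else φ := by
  ext ⟨b, q⟩
  cases b <;> simp [workState]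

theorem workState_single {Q : Type} [DecidableEq Q] (q : Q) :
    workState (fun _ => false) (fun _ => false) (EuclideanSpace.single q 1) =
      EuclideanSpace.single (⟨false, q⟩ : Σ _ : Bool, Q) (1 : ℂ) := by
  ext ⟨b, r⟩
  cases b <;> simp [workState]

/-- Whether the basis state `q` queries the variable in the tape cell with the given offset. -/
def queries {Q : Type} {n : ℕ} (loc : Q → Option (Fin n)) (offset p : ℕ) (q : Q) : Bool :=
  (loc q).elim false fun i => p == offset + i

/-- The work bits when the cells before `p` hold the bits `a`. -/
def sweepBit {Q : Type} {n : ℕ} (loc : Q → Option (Fin n)) (a : ℕ → Bool) (p : ℕ) (q : Q) : Bool :=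
  (loc q).elim false fun i => decide (1 + (i : ℕ) < p) && a (1 + i)

/-- The signs when the cells before `p` hold the bits `a`. -/
def sweepSign {Q : Type} {n : ℕ} (loc : Q → Option (Fin n)) (a : ℕ → Bool) (p : ℕ) (q : Q) : Bool :=
  (loc q).elim false fun i =>
    decide (2 * n + 1 + (i : ℕ) < p) && (a (1 + i) && a (2 * n + 1 + i))

theorem sweepBit_succ {Q : Type} {n : ℕ} (loc : Q → Option (Fin n)) (a : ℕ → Bool) (p : ℕ) (q : Q) :
    sweepBit loc a (p + 1) q = xor (sweepBit loc a p q) (a p && queries loc 1 p q) := by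
  unfold sweepBit queries
  cases loc q with
  | none => simp
  | some i =>
    rcases lt_trichotomy p (1 + i) with h | h | h
    · have e : (p == 1 + (i : ℕ)) = false := by simpa using h.ne
      simp [e, Nat.not_lt.2 h.le, Nat.not_le.2 h]
    · subst h; simp
    · have e : (p == 1 + (i : ℕ)) = false := by simpa using h.ne'
      simp [e, h, h.le]

/-- The work bit is taken at `p + 1` because `cellOp` flips it before it applies the sign. -/
theorem sweepSign_succ {Q : Type} {n : ℕ} (loc : Q → Option (Fin n)) (a : ℕ → Bool) (p : ℕ) (q : Q) :
    sweepSign loc a (p + 1) q = xor (sweepSign loc a p q)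
      (sweepBit loc a (p + 1) q && (a p && queries loc (2 * n + 1) p q)) := by
  unfold sweepSign sweepBit queries
  cases loc q with
  | none => simp
  | some i =>
    rcases lt_trichotomy p (2 * n + 1 + i) with h | h | h
    · have e : (p == 2 * n + 1 + (i : ℕ)) = false := by simpa using h.ne
      simp [e, Nat.not_lt.2 h.le, Nat.not_le.2 h]
    · subst h; simp
    · have e : (p == 2 * n + 1 + (i : ℕ)) = false := by simpa using h.ne'
      simp [e, h, h.le]

variable {Q : Type} [Fintype Q] {n : ℕ}

theorem workState_phase (π : Q → Bool) (φ : EuclideanSpace ℂ Q) :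
    workState (fun _ => false) π φ =
      workState (fun _ => false) (fun _ => false) (phaseFlip π φ) := by
  ext ⟨b, q⟩
  simp [workState, phaseFlip_apply]

theorem inner_workState (φ χ : EuclideanSpace ℂ Q) :
    inner ℂ (workState (fun _ => false) (fun _ => false) φ)
      (workState (fun _ => false) (fun _ => false) χ) = (inner ℂ φ χ : ℂ) := by
  rw [workState_false, workState_false, inner_blocks]
  simp

theorem blockDiag_workState (U : EuclideanSpace ℂ Q ≃ₗᵢ[ℂ] EuclideanSpace ℂ Q)
    (φ : EuclideanSpace ℂ Q) :
    blockDiag (fun _ => U) (workState (fun _ => false) (fun _ => false) φ) =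
      workState (fun _ => false) (fun _ => false) (U φ) := by
  rw [workState_false, workState_false, blockDiag_blocks]
  congr 1
  funext b
  cases b <;> simp

/-- The unitary that flips the work bit of the basis states in `s`. -/
noncomputable def bitFlip (s : Q → Bool) :
    EuclideanSpace ℂ (Σ _ : Bool, Q) ≃ₗᵢ[ℂ] EuclideanSpace ℂ (Σ _ : Bool, Q) :=
  LinearIsometryEquiv.piLpCongrLeft 2 ℂ ℂ
    (Function.Involutive.toPerm (fun bq : Σ _ : Bool, Q => ⟨xor bq.1 (s bq.2), bq.2⟩) fun bq => by
      simp)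

theorem bitFlip_workState (s β π : Q → Bool) (φ : EuclideanSpace ℂ Q) :
    bitFlip s (workState β π φ) = workState (fun q => xor (β q) (s q)) π φ := by
  ext ⟨b, q⟩
  change (if xor b (s q) = β q then (if π q then -φ q else φ q) else 0) =
    if b = xor (β q) (s q) then (if π q then -φ q else φ q) else 0
  have : (xor b (s q) = β q) ↔ (b = xor (β q) (s q)) := by
    cases b <;> cases s q <;> cases β q <;> simp
  simp only [this]

theorem phaseFlip_workState (s β π : Q → Bool) (φ : EuclideanSpace ℂ Q) :
    phaseFlip (fun bq : Σ _ : Bool, Q => bq.1 && s bq.2) (workState β π φ) =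
      workState β (fun q => xor (π q) (β q && s q)) φ := by
  ext ⟨b, q⟩
  simp only [phaseFlip_apply, workState]
  by_cases h : b = β q
  · subst h
    cases β q <;> cases s q <;> cases π q <;> simp
  · simp [h]

/-- Whether a tape symbol is the letter `1`. -/
def TapeSymbol.isOne : TapeSymbol Letter → Bool
  | .letter .one => true
  | _ => false

/-- The operator applied in tape cell `p` during the rightward (`dir = true`) or leftward sweep
that simulates the instruction `o`. -/
noncomputable def cellOp (loc : Q → Option (Fin n))
    (o : Option (EuclideanSpace ℂ Q ≃ₗᵢ[ℂ] EuclideanSpace ℂ Q)) (dir : Bool) (p : ℕ)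
    (σ : TapeSymbol Letter) :
    EuclideanSpace ℂ (Σ _ : Bool, Q) ≃ₗᵢ[ℂ] EuclideanSpace ℂ (Σ _ : Bool, Q) :=
  match o, dir with
  | some U, true => if p = 0 then blockDiag fun _ => U else LinearIsometryEquiv.refl ℂ _
  | some _, false => LinearIsometryEquiv.refl ℂ _
  | none, true =>
    if σ.isOne then (bitFlip (queries loc 1 p)).trans
      (phaseFlip fun bq => bq.1 && queries loc (2 * n + 1) p bq.2)
    else LinearIsometryEquiv.refl ℂ _
  | none, false => if σ.isOne then bitFlip (queries loc 1 p) else LinearIsometryEquiv.refl ℂ _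

theorem cellOp_none_right (loc : Q → Option (Fin n)) (a : ℕ → Bool) (p : ℕ)
    (σ : TapeSymbol Letter) (hσ : σ.isOne = a p) (φ : EuclideanSpace ℂ Q) :
    cellOp loc none true p σ (workState (sweepBit loc a p) (sweepSign loc a p) φ) =
      workState (sweepBit loc a (p + 1)) (sweepSign loc a (p + 1)) φ := by
  rw [funext (sweepSign_succ loc a p), funext (sweepBit_succ loc a p)]
  cases ha : a p
  · simp [cellOp, hσ, ha]
  · simp only [cellOp, hσ, ha, if_true, LinearIsometryEquiv.trans_apply, bitFlip_workState,
      phaseFlip_workState, Bool.true_and]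

/-- The leftward sweep repeats the bit flips in reverse order, which erases the work bits and leaves
the signs. -/
theorem cellOp_none_left (loc : Q → Option (Fin n)) (a : ℕ → Bool) (p : ℕ)
    (σ : TapeSymbol Letter) (hσ : σ.isOne = a p) (π : Q → Bool) (φ : EuclideanSpace ℂ Q) :
    cellOp loc none false p σ (workState (sweepBit loc a (p + 1)) π φ) =
      workState (sweepBit loc a p) π φ := by
  rw [funext (sweepBit_succ loc a p)]
  cases ha : a p
  · simp [cellOp, hσ, ha]
  · simp [cellOp, hσ, ha, bitFlip_workState]

/-! ### The sweeping automaton -/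

/-- Whether `σ` may stand in cell `p` of the tape with content `x #^n y`. -/
def expected (n p : ℕ) : TapeSymbol Letter → Bool
  | .leftEnd => p = 0
  | .rightEnd => p = 3 * n + 1
  | .letter .hash => n < p ∧ p ≤ 2 * n
  | .letter _ => (1 ≤ p ∧ p ≤ n) ∨ (2 * n < p ∧ p ≤ 3 * n)

/-- The states of the sweeping automaton: round, direction and position of a sweep, or
measurement, acceptance, rejection. -/
abbrev SweepState (L n : ℕ) : Type := (Fin (L + 1) × Bool × Fin (3 * n + 2)) ⊕ Fin 3

/-- The successor of a state in a sweep, and the head move. -/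
def sweepNext (L n : ℕ) (k : Fin (L + 1)) (p : Fin (3 * n + 2)) :
    Bool → SweepState L n × HeadMove
  | true =>
    if h : (p : ℕ) < 3 * n + 1 then (.inl (k, true, ⟨p + 1, by omega⟩), .right)
    else (.inl (k, false, p), .stay)
  | false =>
    if (p : ℕ) = 0 then
      if h : (k : ℕ) < L then (.inl (⟨k + 1, by omega⟩, true, ⟨0, by omega⟩), .stay)
      else (.inr 0, .stay)
    else (.inl (k, false, ⟨p - 1, by omega⟩), .left)

/-- The transition function of the sweeping automaton. -/
noncomputable def sweepTrans (loc : Q → Option (Fin n)) (l : QProg Q) (ψ : EuclideanSpace ℂ Q) :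
    SweepState l.length n → TapeSymbol Letter → Instruction (Σ _ : Bool, Q) (SweepState l.length n)
  | .inl (k, dir, p), σ =>
    if expected n p σ then
      .unitary (cellOp loc (l.getD k (some (LinearIsometryEquiv.refl ℂ _))) dir p σ)
        (sweepNext l.length n k p dir)
    else .unitary (LinearIsometryEquiv.refl ℂ _) (.inr 2, .stay)
  | .inr _, _ =>
    .measure (subspaceMeasurement
      (Submodule.span ℂ {workState (fun _ => false) (fun _ => false) ψ}))
      fun i => (.inr (if i.val = 0 then 2 else 1), .stay)

/-- The operation of round `k`. -/
noncomputable def roundOp (l : QProg Q) (k : ℕ) :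
    Option (EuclideanSpace ℂ Q ≃ₗᵢ[ℂ] EuclideanSpace ℂ Q) :=
  l.getD k (some (LinearIsometryEquiv.refl ℂ _))

/-- This includes `k` beyond the end of `l`, where the default operation is the identity; the last
round of the automaton is such an idle round. -/
theorem progEval_take_succ (l : QProg Q) (z : Fin n → Bool) (k : ℕ) (v : EuclideanSpace ℂ Q) :
    progEval loc z (l.take (k + 1)) v =
      opEval loc z (roundOp l k) (progEval loc z (l.take k) v) := by
  rw [List.take_add_one, progEval_append, roundOp, List.getD_eq_getElem?_getD]
  cases l[k]? <;> rfl

variable [DecidableEq Q]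

/-- The automaton that simulates the query program `l`, started in the basis state `q₀`, on the
conjunction of `x` and `y`, and accepts the words `x #^n y` for which the result is orthogonal
to `ψ`. -/
noncomputable abbrev sweepAutomaton (loc : Q → Option (Fin n)) (l : QProg Q) (q₀ : Q)
    (ψ : EuclideanSpace ℂ Q) : TwoQCFA Letter where
  Q := Σ _ : Bool, Q
  S := SweepState l.length n
  q₀ := ⟨false, q₀⟩
  s₀ := .inl (0, true, 0)
  acc := {.inr 1}
  rej := {.inr 2}
  disjoint_acc_rej := by simp
  trans := sweepTrans loc l ψ
  not_left s := by
    rcases s with ⟨k, dir, p⟩ | j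
    · unfold sweepTrans
      by_cases h : (p : ℕ) = 0
      · cases dir
        · simp only [expected, h, sweepNext]
          split_ifs <;> simp [Instruction.CanMove]
        · simp only [expected, h, sweepNext]
          split_ifs <;> simp [Instruction.CanMove]
      · simp [expected, h, Instruction.CanMove]
    · simp [sweepTrans, Instruction.CanMove]
  not_right s := by
    rcases s with ⟨k, dir, p⟩ | j
    · unfold sweepTrans
      by_cases h : (p : ℕ) = 3 * n + 1
      · cases dir
        · simp only [expected, h, sweepNext]
          split_ifs <;> simp [Instruction.CanMove]
        · simp [expected, h, sweepNext, Instruction.CanMove]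
      · simp [expected, h, Instruction.CanMove]
    · simp [sweepTrans, Instruction.CanMove]

/-! ### Runs of the sweeping automaton -/

variable {loc : Q → Option (Fin n)} {l : QProg Q} {q₀ : Q} {ψ : EuclideanSpace ℂ Q}
  {w : List Letter}

/-- The configuration in round `k` with the head at position `p`. -/
noncomputable def sweepConfig (loc : Q → Option (Fin n)) (l : QProg Q) (q₀ : Q)
    (ψ : EuclideanSpace ℂ Q) (k : Fin (l.length + 1)) (dir : Bool) (p : Fin (3 * n + 2))
    (v : EuclideanSpace ℂ (Σ _ : Bool, Q)) : (sweepAutomaton loc l q₀ ψ).Config :=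
  ⟨.inl (k, dir, p), p, v⟩

theorem reaches_sweepNext (k : Fin (l.length + 1)) (dir : Bool) (p : Fin (3 * n + 2))
    (h : expected n p (TwoQCFA.tape w p)) (v : EuclideanSpace ℂ (Σ _ : Bool, Q)) :
    (sweepAutomaton loc l q₀ ψ).Reaches w 1 (sweepConfig loc l q₀ ψ k dir p v)
      ((sweepConfig loc l q₀ ψ k dir p v).move (sweepNext l.length n k p dir)
        (cellOp loc (roundOp l k) dir p (TwoQCFA.tape w p) v)) := by
  refine TwoQCFA.Reaches.unitary (by simp [sweepConfig]) ?_
  change sweepTrans loc l ψ (.inl (k, dir, p)) (TwoQCFA.tape w p) = _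
  simp only [sweepTrans]
  rw [if_pos h]
  rfl

/-- Only the cells before `p` need to be as expected, so this also covers the run up to the first
wrong cell. -/
theorem reaches_right (k : Fin (l.length + 1)) (f : ℕ → EuclideanSpace ℂ (Σ _ : Bool, Q))
    (hf : ∀ p, cellOp loc (roundOp l k) true p (TwoQCFA.tape w p) (f p) = f (p + 1))
    (p : ℕ) (hp : p < 3 * n + 2) (h : ∀ r < p, expected n r (TwoQCFA.tape w r)) :
    (sweepAutomaton loc l q₀ ψ).Reaches w p (sweepConfig loc l q₀ ψ k true 0 (f 0))
      (sweepConfig loc l q₀ ψ k true ⟨p, hp⟩ (f p)) := by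
  induction p with
  | zero => exact .rfl
  | succ p ih =>
    refine (ih (by omega) fun r hr => h r (by omega)).trans ?_
    have := reaches_sweepNext (loc := loc) (q₀ := q₀) (ψ := ψ) (w := w) k true ⟨p, by omega⟩
      (h p (by omega)) (f p)
    rw [hf, sweepNext, dif_pos (show p < 3 * n + 1 by omega)] at this
    exact this

/-- Here `g (p + 1)` is the state before cell `p` is processed, so that `g` has the same indexing as
the rightward states. -/
theorem reaches_left (k : Fin (l.length + 1)) (g : ℕ → EuclideanSpace ℂ (Σ _ : Bool, Q))
    (hg : ∀ p, cellOp loc (roundOp l k) false p (TwoQCFA.tape w p) (g (p + 1)) = g p)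
    (h : ∀ r ≤ 3 * n + 1, expected n r (TwoQCFA.tape w r)) (p : ℕ) (hp : p < 3 * n + 2) :
    (sweepAutomaton loc l q₀ ψ).Reaches w p (sweepConfig loc l q₀ ψ k false ⟨p, hp⟩ (g (p + 1)))
      (sweepConfig loc l q₀ ψ k false 0 (g 1)) := by
  induction p with
  | zero => exact .rfl
  | succ p ih =>
    have := reaches_sweepNext (loc := loc) (q₀ := q₀) (ψ := ψ) (w := w) k false ⟨p + 1, hp⟩
      (h _ (by omega)) (g (p + 1 + 1))
    rw [hg, sweepNext, if_neg (show ¬ p + 1 = 0 by omega)] at this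
    have key := TwoQCFA.Reaches.trans (M := sweepAutomaton loc l q₀ ψ) this (ih (by omega))
    rw [Nat.add_comm 1 p] at key
    exact key

/-- The configuration at the beginning of round `k`, or at the measurement. -/
noncomputable def roundConfig (loc : Q → Option (Fin n)) (l : QProg Q) (q₀ : Q)
    (ψ : EuclideanSpace ℂ Q) (k : ℕ) (φ : EuclideanSpace ℂ Q) :
    (sweepAutomaton loc l q₀ ψ).Config :=
  if h : k < l.length + 1 then
    sweepConfig loc l q₀ ψ ⟨k, h⟩ true 0 (workState (fun _ => false) (fun _ => false) φ)
  else ⟨.inr 0, 0, workState (fun _ => false) (fun _ => false) φ⟩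

theorem reaches_of_sweeps (k : Fin (l.length + 1)) (f g : ℕ → EuclideanSpace ℂ (Σ _ : Bool, Q))
    (hf : ∀ p, cellOp loc (roundOp l k) true p (TwoQCFA.tape w p) (f p) = f (p + 1))
    (hg : ∀ p, cellOp loc (roundOp l k) false p (TwoQCFA.tape w p) (g (p + 1)) = g p)
    (hfg : f (3 * n + 2) = g (3 * n + 2)) (φ χ : EuclideanSpace ℂ Q)
    (hφ : f 0 = workState (fun _ => false) (fun _ => false) φ)
    (hχ : g 0 = workState (fun _ => false) (fun _ => false) χ)
    (h : ∀ r ≤ 3 * n + 1, expected n r (TwoQCFA.tape w r)) :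
    (sweepAutomaton loc l q₀ ψ).Reaches w (2 * (3 * n + 2)) (roundConfig loc l q₀ ψ k φ)
      (roundConfig loc l q₀ ψ (k + 1) χ) := by
  have h1 := reaches_right (loc := loc) (q₀ := q₀) (ψ := ψ) (w := w) k f hf (3 * n + 1) (by omega)
    fun r hr => h r (by omega)
  have h2 := reaches_sweepNext (loc := loc) (q₀ := q₀) (ψ := ψ) (w := w) k true
    ⟨3 * n + 1, by omega⟩ (h _ le_rfl) (f (3 * n + 1))
  rw [hf, hfg, sweepNext, dif_neg (show ¬ 3 * n + 1 < 3 * n + 1 by omega)] at h2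
  have h3 := reaches_left (loc := loc) (q₀ := q₀) (ψ := ψ) (w := w) k g hg h (3 * n + 1)
    (by omega)
  have h4 := reaches_sweepNext (loc := loc) (q₀ := q₀) (ψ := ψ) (w := w) k false
    0 (h 0 (by omega)) (g 1)
  have h4' : (sweepConfig loc l q₀ ψ k false 0 (g 1)).move (sweepNext l.length n k 0 false)
      (cellOp loc (roundOp l k) false 0 (TwoQCFA.tape w 0) (g 1)) =
      roundConfig loc l q₀ ψ (k + 1) χ := by
    rw [hg, hχ, sweepNext, if_pos (by simp), roundConfig]
    by_cases hk : (k : ℕ) < l.length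
    · rw [dif_pos hk, dif_pos (by omega)]
      rfl
    · rw [dif_neg hk, dif_neg (by omega)]
      rfl
  have h1' : sweepConfig loc l q₀ ψ k true 0 (f 0) = roundConfig loc l q₀ ψ k φ := by
    rw [roundConfig, dif_pos k.2, hφ]
  rw [h1'] at h1
  have h4'' : (sweepAutomaton loc l q₀ ψ).Reaches w 1 (sweepConfig loc l q₀ ψ k false 0 (g 1))
      (roundConfig loc l q₀ ψ (k + 1) χ) := h4' ▸ h4
  have := ((h1.trans h2).trans h3).trans h4''
  -- Both turns take a step without head movement, so each sweep uses `3 * n + 2` steps.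
  rwa [show 3 * n + 1 + 1 + (3 * n + 1) + 1 = 2 * (3 * n + 2) by ring] at this

/-- The conjunction of the two bit strings on the tape. -/
def tapeAnd (n : ℕ) (w : List Letter) (i : Fin n) : Bool :=
  (TwoQCFA.tape w (1 + i)).isOne && (TwoQCFA.tape w (2 * n + 1 + i)).isOne

theorem reaches_round (k : Fin (l.length + 1)) (φ : EuclideanSpace ℂ Q)
    (h : ∀ r ≤ 3 * n + 1, expected n r (TwoQCFA.tape w r)) :
    (sweepAutomaton loc l q₀ ψ).Reaches w (2 * (3 * n + 2)) (roundConfig loc l q₀ ψ k φ)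
      (roundConfig loc l q₀ ψ (k + 1) (opEval loc (tapeAnd n w) (roundOp l k) φ)) := by
  cases hU : roundOp l k with
  | some U =>
    refine reaches_of_sweeps k
      (fun p => workState (fun _ => false) (fun _ => false) (if p = 0 then φ else U φ))
      (fun _ => workState (fun _ => false) (fun _ => false) (U φ)) ?_ ?_ ?_ _ _ ?_ ?_ h
    · intro p
      rw [hU]
      by_cases hp : p = 0
      · simp [cellOp, hp, blockDiag_workState]
      · simp [cellOp, hp]
    · intro p
      rw [hU]
      simp [cellOp]
    · simp
    · simp
    · rfl
  | none =>
    -- On the way back the signs keep their final value, and only the work bits are undone.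
    set a : ℕ → Bool := fun p => (TwoQCFA.tape w p).isOne with ha
    refine reaches_of_sweeps k (fun p => workState (sweepBit loc a p) (sweepSign loc a p) φ)
      (fun p => workState (sweepBit loc a p) (sweepSign loc a (3 * n + 2)) φ) ?_ ?_ rfl _ _ ?_ ?_ h
    · intro p
      rw [hU]
      exact cellOp_none_right loc a p _ rfl φ
    · intro p
      rw [hU]
      exact cellOp_none_left loc a p _ rfl _ φ
    · congr 1 <;> funext q <;> simp only [sweepBit, sweepSign] <;> cases loc q <;> simp
    · have h1 : sweepBit loc a 0 = fun _ => false := by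
        funext q
        simp only [sweepBit]
        cases loc q <;> simp
      have h2 : sweepSign loc a (3 * n + 2) = oracleBit loc (tapeAnd n w) := by
        funext q
        simp only [sweepSign, oracleBit]
        cases loc q with
        | none => rfl
        | some i => simp [ha, tapeAnd, show 2 * n + 1 + (i : ℕ) < 3 * n + 2 by omega]
      change workState (sweepBit loc a 0) _ φ = _
      rw [h1, h2, workState_phase]
      rfl

theorem reaches_rounds (h : ∀ r ≤ 3 * n + 1, expected n r (TwoQCFA.tape w r)) (k : ℕ)
    (hk : k ≤ l.length + 1) :
    (sweepAutomaton loc l q₀ ψ).Reaches w (k * (2 * (3 * n + 2)))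
      (sweepAutomaton loc l q₀ ψ).init
      (roundConfig loc l q₀ ψ k
        (progEval loc (tapeAnd n w) (l.take k) (EuclideanSpace.single q₀ 1))) := by
  induction k with
  | zero =>
    have : roundConfig loc l q₀ ψ 0
        (progEval loc (tapeAnd n w) (l.take 0) (EuclideanSpace.single q₀ 1)) =
        (sweepAutomaton loc l q₀ ψ).init := by
      rw [roundConfig, dif_pos (by omega)]
      change sweepConfig loc l q₀ ψ _ true 0
        (workState (fun _ => false) (fun _ => false) (EuclideanSpace.single q₀ 1)) = _
      rw [workState_single]
      rfl
    rw [this, Nat.zero_mul]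
    exact .rfl
  | succ k ih =>
    rw [Nat.succ_mul, progEval_take_succ]
    exact (ih (by omega)).trans (reaches_round ⟨k, by omega⟩ _ h)

/-- The running time of the sweeping automaton. -/
def sweepTime (L n : ℕ) : ℕ := 1 + (L + 1) * (2 * (3 * n + 2))

theorem haltProbWithin_measure {v : EuclideanSpace ℂ (Σ _ : Bool, Q)} (hv : ‖v‖ = 1)
    (F : Finset (SweepState l.length n)) (b : Bool)
    (hb : v ∈ if b then (Submodule.span ℂ {workState (fun _ => false) (fun _ => false) ψ})ᗮ
      else (Submodule.span ℂ {workState (fun _ => false) (fun _ => false) ψ}))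
    (hF0 : (.inr 0 : SweepState l.length n) ∉ F)
    (hF : (.inr (if b then 1 else 2) : SweepState l.length n) ∈ F) :
    (sweepAutomaton loc l q₀ ψ).haltProbWithin w F 1 ⟨.inr 0, 0, v⟩ = 1 := by
  set K := Submodule.span ℂ {workState (fun _ => false) (fun _ => false) ψ} with hK
  have hv' : ‖v‖ₑ = 1 := by rw [← ofReal_norm, hv, ENNReal.ofReal_one]
  rw [TwoQCFA.haltProbWithin]
  rw [if_neg hF0, if_neg (by simp)]
  change ∑ i : Fin 2, ‖(![K.starProjection, Kᗮ.starProjection] i) v‖ₑ ^ 2 * _ = _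
  rw [Fin.sum_univ_two]
  cases b
  · have h1 : K.starProjection v = v := Submodule.starProjection_eq_self_iff.2 hb
    have h2 : Kᗮ.starProjection v = 0 := K.starProjection_orthogonal_apply_eq_zero hb
    simp only [Matrix.cons_val_zero, Matrix.cons_val_one, h1, h2, hv']
    rw [TwoQCFA.haltProbWithin_of_mem (M := sweepAutomaton loc l q₀ ψ) (F := F) hF]
    simp
  · have h1 : K.starProjection v = 0 := (Submodule.starProjection_apply_eq_zero_iff K).2 hb
    have h2 : Kᗮ.starProjection v = v := Submodule.starProjection_eq_self_iff.2 hb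
    simp only [Matrix.cons_val_zero, Matrix.cons_val_one, h1, h2, hv']
    rw [enorm_zero, zero_pow two_ne_zero, zero_mul, zero_add, one_pow, one_mul]
    exact TwoQCFA.haltProbWithin_of_mem (M := sweepAutomaton loc l q₀ ψ) hF _

theorem haltsWithin_measure (v : EuclideanSpace ℂ (Σ _ : Bool, Q)) :
    (sweepAutomaton loc l q₀ ψ).HaltsWithin w 1 ⟨.inr 0, 0, v⟩ := by
  refine Or.inr ?_
  intro i _
  change (.inr (if i.val = 0 then 2 else 1) : SweepState l.length n) ∈
    ({.inr 1} ∪ {.inr 2} : Finset (SweepState l.length n))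
  split_ifs <;> simp

/-- A wrong word is caught in the first rightward sweep, at its first unexpected cell; no
measurement has been made, so the quantum state is irrelevant. -/
theorem reject_of_unexpected (h : ¬ ∀ r ≤ 3 * n + 1, expected n r (TwoQCFA.tape w r)) :
    (sweepAutomaton loc l q₀ ψ).HaltsWithin w (sweepTime l.length n)
        (sweepAutomaton loc l q₀ ψ).init ∧
      1 ≤ (sweepAutomaton loc l q₀ ψ).rejectProb w := by
  push Not at h
  classical
  have hp := Nat.find_spec h
  have hmin := fun r => Nat.find_min h (m := r)
  set p := Nat.find h
  set f : ℕ → EuclideanSpace ℂ (Σ _ : Bool, Q) := fun p =>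
    Nat.rec (EuclideanSpace.single ⟨false, q₀⟩ 1)
      (fun p v => cellOp loc (roundOp l 0) true p (TwoQCFA.tape w p) v) p with hf
  have h1 := reaches_right (loc := loc) (q₀ := q₀) (ψ := ψ) (w := w) (0 : Fin (l.length + 1)) f
    (fun p => rfl) p (by omega) fun r hr => by
      by_contra hcon
      exact hmin r hr ⟨by omega, hcon⟩
  have h2 : (sweepAutomaton loc l q₀ ψ).Reaches w 1
      (sweepConfig loc l q₀ ψ 0 true ⟨p, by omega⟩ (f p)) ⟨.inr 2, p, f p⟩ := by
    refine TwoQCFA.Reaches.unitary (M := sweepAutomaton loc l q₀ ψ)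
      (U := LinearIsometryEquiv.refl ℂ _) (next := (.inr 2, .stay)) (by simp [sweepConfig]) ?_
    change sweepTrans loc l ψ (.inl (0, true, ⟨p, by omega⟩)) (TwoQCFA.tape w p) = _
    simp only [sweepTrans]
    rw [if_neg hp.2]
  have h3 := h1.trans h2
  have hle : p + 1 ≤ sweepTime l.length n := by
    have : 1 * (2 * (3 * n + 2)) ≤ (l.length + 1) * (2 * (3 * n + 2)) :=
      Nat.mul_le_mul_right _ (by omega)
    unfold sweepTime
    omega
  constructor
  · have := h3.halts (sweepTime l.length n - (p + 1)) (TwoQCFA.haltsWithin_of_mem (by simp) _)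
    rwa [Nat.sub_add_cancel hle] at this
  · have := h3.prob _ Finset.subset_union_right 0
    rw [TwoQCFA.haltProbWithin_of_mem (by simp)] at this
    exact le_iSup_of_le (0 + (p + 1)) this.le

theorem halts_and_prob_of_expected
    (h : ∀ r ≤ 3 * n + 1, expected n r (TwoQCFA.tape w r)) (b : Bool)
    (hb0 : b = false → progEval loc (tapeAnd n w) l (EuclideanSpace.single q₀ 1) = ψ)
    (hb1 : b = true →
      inner ℂ ψ (progEval loc (tapeAnd n w) l (EuclideanSpace.single q₀ 1)) = (0 : ℂ)) :
    (sweepAutomaton loc l q₀ ψ).HaltsWithin w (sweepTime l.length n)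
        (sweepAutomaton loc l q₀ ψ).init ∧
      1 ≤ if b then (sweepAutomaton loc l q₀ ψ).acceptProb w
        else (sweepAutomaton loc l q₀ ψ).rejectProb w := by
  have h1 := reaches_rounds (loc := loc) (q₀ := q₀) (ψ := ψ) (l := l) h (l.length + 1) le_rfl
  rw [List.take_of_length_le (by omega), roundConfig, dif_neg (by omega)] at h1
  set v := progEval loc (tapeAnd n w) l (EuclideanSpace.single q₀ 1) with hv
  have hv1 : ‖workState (fun _ => false) (fun _ => false) v‖ = 1 := by
    rw [workState_false]
    apply norm_blocks_eq_one
    simp [hv]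
  refine ⟨h1.halts 1 (haltsWithin_measure _), ?_⟩
  cases b
  · have h2 := haltProbWithin_measure (loc := loc) (q₀ := q₀) (ψ := ψ) (w := w) (l := l) hv1
      {.inr 2} false (by simp [hb0 rfl, Submodule.mem_span_singleton_self]) (by simp) (by simp)
    have h3 := h1.prob {.inr 2} Finset.subset_union_right 1
    exact le_iSup_of_le _ (h2.symm.trans h3).le
  · have h2 := haltProbWithin_measure (loc := loc) (q₀ := q₀) (ψ := ψ) (w := w) (l := l) hv1
      {.inr 1} true (by
        simp only [if_true]
        rw [Submodule.mem_orthogonal_singleton_iff_inner_right, inner_workState]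
        exact hb1 rfl) (by simp) (by simp)
    have h3 := h1.prob {.inr 1} Finset.subset_union_left 1
    exact le_iSup_of_le _ (h2.symm.trans h3).le

/-! ### The words of the right form -/

theorem tape_succ (w : List Letter) (j : ℕ) :
    TwoQCFA.tape w (j + 1) = (w[j]?).elim .rightEnd .letter := by
  simp only [TwoQCFA.tape, List.getD_eq_getElem?_getD, List.getElem?_cons_succ, List.getElem?_map]
  cases w[j]? <;> rfl

/-- The word `x #^n y`. -/
def hashWord (x y : Fin n → Bool) : List Letter :=
  bitWord x ++ List.replicate n Letter.hash ++ bitWord y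

theorem getElem?_hashWord (x y : Fin n → Bool) (j : ℕ) :
    (hashWord x y)[j]? = if h : j < n then some (.ofBool (x ⟨j, h⟩))
      else if j < 2 * n then some .hash
      else if h : j - 2 * n < n then some (.ofBool (y ⟨j - 2 * n, h⟩)) else none := by
  have hlen : (bitWord x).length = n := by simp [bitWord]
  unfold hashWord
  rw [List.append_assoc]
  by_cases h1 : j < n
  · rw [List.getElem?_append_left (by omega), dif_pos h1]
    simp [bitWord, h1]
  · rw [List.getElem?_append_right (by omega), dif_neg h1, hlen]
    by_cases h2 : j < 2 * n
    · rw [List.getElem?_append_left (by simp; omega), if_pos h2]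
      rw [List.getElem?_replicate, if_pos (by omega)]
    · rw [List.getElem?_append_right (by simp; omega), if_neg h2]
      rw [List.length_replicate, show j - n - n = j - 2 * n by omega]
      simp only [bitWord, List.getElem?_map, List.getElem?_ofFn]
      split_ifs <;> rfl

theorem isOne_letter_ofBool (b : Bool) : (TapeSymbol.letter (Letter.ofBool b)).isOne = b := by
  cases b <;> rfl

theorem expected_letter_ofBool (p : ℕ) (b : Bool) :
    expected n p (.letter (.ofBool b)) = true ↔
      (1 ≤ p ∧ p ≤ n) ∨ (2 * n < p ∧ p ≤ 3 * n) := by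
  cases b <;> simp [Letter.ofBool, expected]

theorem expected_hashWord (x y : Fin n → Bool) {r : ℕ} (hr : r ≤ 3 * n + 1) :
    expected n r (TwoQCFA.tape (hashWord x y) r) := by
  rcases r with _ | j
  · rfl
  · rw [tape_succ, getElem?_hashWord]
    split_ifs
    · exact (expected_letter_ofBool _ _).2 (by omega)
    · simp only [Option.elim, expected, decide_eq_true_eq]; omega
    · exact (expected_letter_ofBool _ _).2 (by omega)
    · simp only [Option.elim, expected, decide_eq_true_eq]; omega

theorem tapeAnd_hashWord (x y : Fin n → Bool) :
    tapeAnd n (hashWord x y) = fun i => x i && y i := by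
  funext i
  unfold tapeAnd
  rw [add_comm 1, add_right_comm, tape_succ, tape_succ, getElem?_hashWord, getElem?_hashWord,
    dif_pos i.2, dif_neg (by omega), if_neg (by omega), dif_pos (by omega)]
  simp [isOne_letter_ofBool]

/-- The right end-marker in cell `3 * n + 1` bounds the length from above, and the letters required
before it bound it from below. -/
theorem exists_eq_hashWord (h : ∀ r ≤ 3 * n + 1, expected n r (TwoQCFA.tape w r)) :
    ∃ x y : Fin n → Bool, w = hashWord x y := by
  have hbit : ∀ j, ((1 ≤ j + 1 ∧ j + 1 ≤ n) ∨ (2 * n < j + 1 ∧ j + 1 ≤ 3 * n)) →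
      w[j]? = some (.ofBool (TwoQCFA.tape w (j + 1)).isOne) := by
    intro j hj
    have h1 := h (j + 1) (by omega)
    rw [tape_succ] at h1 ⊢
    cases hw : w[j]? with
    | none => simp [hw, expected] at h1; omega
    | some a =>
      cases a
      · rfl
      · rfl
      · simp [hw, expected] at h1; omega
  refine ⟨fun i => (TwoQCFA.tape w (i + 1)).isOne,
    fun i => (TwoQCFA.tape w (2 * n + i + 1)).isOne, List.ext_getElem? fun j => ?_⟩
  rw [getElem?_hashWord]
  split_ifs with h1 h2 h3
  · exact hbit j (by omega)
  · have h4 := h (j + 1) (by omega)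
    rw [tape_succ] at h4
    cases hw : w[j]? with
    | none => simp [hw, expected] at h4; omega
    | some a =>
      cases a
      · simp [hw, expected] at h4; omega
      · simp [hw, expected] at h4; omega
      · rfl
  · rw [hbit j (by omega)]
    simp only [show 2 * n + (j - 2 * n) = j by omega]
  · have h4 := h (3 * n + 1) le_rfl
    rw [tape_succ] at h4
    have h5 : w[3 * n]? = none := by
      cases hw : w[3 * n]? with
      | none => rfl
      | some a => cases a <;> simp [hw, expected] at h4 <;> omega
    rw [List.getElem?_eq_none_iff] at h5 ⊢
    omega

theorem sweepAutomaton_spec (f : (Fin n → Bool) → Bool)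
    (hf0 : ∀ z, f z = false → progEval loc z l (EuclideanSpace.single q₀ 1) = ψ)
    (hf1 : ∀ z, f z = true →
      inner ℂ ψ (progEval loc z l (EuclideanSpace.single q₀ 1)) = (0 : ℂ)) :
    (sweepAutomaton loc l q₀ ψ).RecognizesExactly
        {w | ∃ x y : Fin n → Bool, f (fun i => x i && y i) = true ∧ w = hashWord x y} ∧
      (sweepAutomaton loc l q₀ ψ).RunsInTime (sweepTime l.length n) := by
  refine ⟨⟨?_, ?_⟩, fun w => ?_⟩
  · rintro w ⟨x, y, hxy, rfl⟩
    rw [tsub_zero]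
    have := (halts_and_prob_of_expected (loc := loc) (q₀ := q₀) (l := l) (w := hashWord x y)
      (fun r hr => expected_hashWord x y hr) true (by simp)
      fun _ => hf1 _ (by rw [tapeAnd_hashWord]; exact hxy)).2
    simpa using this
  · intro w hw
    rw [tsub_zero]
    by_cases h : ∀ r ≤ 3 * n + 1, expected n r (TwoQCFA.tape w r)
    · obtain ⟨x, y, rfl⟩ := exists_eq_hashWord h
      have hz : f (fun i => x i && y i) = false := by
        by_contra hcon
        exact hw ⟨x, y, by simpa using hcon, rfl⟩
      have := (halts_and_prob_of_expected (loc := loc) (q₀ := q₀) (l := l) h false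
        (fun _ => hf0 _ (by rw [tapeAnd_hashWord]; exact hz)) (by simp)).2
      simpa using this
    · exact (reject_of_unexpected h).2
  · by_cases h : ∀ r ≤ 3 * n + 1, expected n r (TwoQCFA.tape w r)
    · exact (halts_and_prob_of_expected (loc := loc) (q₀ := q₀) (l := l) h
        (f (tapeAnd n w)) (hf0 _) (hf1 _)).1
    · exact (reject_of_unexpected h).1

end Sweep

/-! ### Resources -/

/-- The automaton must start in a basis state, so the program gets a first instruction preparing
`ψ`, found by extending `ψ` to an orthonormal basis. -/
theorem exists_unitary_single {Q : Type} [Fintype Q] [DecidableEq Q] {ψ : EuclideanSpace ℂ Q}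
    (hψ : ‖ψ‖ = 1) : ∃ (q₀ : Q) (U : EuclideanSpace ℂ Q ≃ₗᵢ[ℂ] EuclideanSpace ℂ Q),
      U (EuclideanSpace.single q₀ 1) = ψ := by
  have hne : Nonempty Q := by
    by_contra hemp
    rw [not_nonempty_iff] at hemp
    have : ψ = 0 := Subsingleton.elim _ _
    simp [this] at hψ
  obtain ⟨q₀⟩ := hne
  have horth : Orthonormal ℂ (({q₀} : Set Q).domRestrict fun _ => ψ) := by
    refine ⟨fun _ => hψ, fun i j hij => ?_⟩
    exact absurd (Subsingleton.elim i j) hij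
  obtain ⟨b, hb⟩ := horth.exists_orthonormalBasis_extension_of_card_eq (by simp)
  exact ⟨q₀, b.repr.symm, by rw [b.repr_symm_single]; exact hb q₀ rfl⟩

theorem exists_exact_automaton (k r : ℕ) :
    ∃ (M : TwoQCFA Letter) (T : ℕ),
      M.RecognizesExactly (LNE (8 * k + r)) ∧ M.RunsInTime T ∧
      T ≤ 31 * 4 ^ r * 3 ^ (8 * k + r) * 2048 ^ k ∧
      Fintype.card M.Q ≤ 4 * 6 ^ (8 * k + r) ∧ Fintype.card M.S ≤ T + 3 := by
  -- Overlap 0 makes the final measurement exact.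
  have hC := (ComputesNE.exists_neg_one k r).raise (p' := 0) (by norm_num) (by norm_num)
    (by norm_num)
  set d := 8 * k + r
  obtain ⟨Q, _, _, loc, l, ψ, hQ, hl, hψ, hA⟩ := hC
  obtain ⟨q₀, U, hU⟩ := exists_unitary_single hψ
  have hev : ∀ z, progEval loc z (some U :: l) (EuclideanSpace.single q₀ 1) =
      progEval loc z l ψ := fun z => by
    rw [← hU]; rfl
  have hspec := sweepAutomaton_spec (loc := loc) (l := some U :: l) (q₀ := q₀) (ψ := ψ) (NEiter d)
    (fun z hz => by rw [hev, (hA z).1 hz])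
    (fun z hz => by rw [hev, (hA z).2 hz, Complex.ofReal_zero])
  refine ⟨sweepAutomaton loc (some U :: l) q₀ ψ, _, hspec.1, hspec.2, ?_, ?_, ?_⟩
  · have h1 : 0 < 2048 ^ k * 4 ^ r := by positivity
    have h2 : 0 < 3 ^ d := by positivity
    have h3 : (some U :: l).length + 1 ≤ 3 * (2048 ^ k * 4 ^ r) := by
      rw [mul_assoc] at hl
      simp only [List.length_cons]
      omega
    calc sweepTime (some U :: l).length (3 ^ d)
        ≤ 1 + 3 * (2048 ^ k * 4 ^ r) * (2 * (5 * 3 ^ d)) := by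
          unfold sweepTime
          gcongr
          omega
      _ ≤ 31 * 4 ^ r * 3 ^ d * 2048 ^ k := by
          have h4 : 0 < 2048 ^ k * 4 ^ r * 3 ^ d := by positivity
          have e1 : 3 * (2048 ^ k * 4 ^ r) * (2 * (5 * 3 ^ d)) =
            30 * (2048 ^ k * 4 ^ r * 3 ^ d) := by ring
          have e2 : 31 * 4 ^ r * 3 ^ d * 2048 ^ k = 31 * (2048 ^ k * 4 ^ r * 3 ^ d) := by ring
          omega
  · change Fintype.card (Σ _ : Bool, Q) ≤ _
    simp only [Fintype.card_sigma, Fintype.sum_bool]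
    omega
  · change Fintype.card (SweepState (some U :: l).length (3 ^ d)) ≤ _
    simp only [Fintype.card_sum, Fintype.card_prod, Fintype.card_fin, Fintype.card_bool, sweepTime]
    omega

theorem two_thousand_forty_eight_pow_le (k r : ℕ) :
    (2048 : ℝ) ^ k ≤ (3 ^ (8 * k + r) : ℝ) ^ (0.87 : ℝ) := by
  have h1 : (2048 : ℝ) ≤ (3 ^ 8 : ℝ) ^ (0.87 : ℝ) := by
    -- The 25th power makes the exponent `8 * 0.87 * 25 = 174` integral, leaving `2048 ^ 25 ≤ 3 ^
    -- 174`.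
    rw [← pow_le_pow_iff_left₀ (by norm_num) (by positivity) (show (25 : ℕ) ≠ 0 by norm_num),
      ← Real.rpow_natCast _ 25, ← Real.rpow_natCast _ 25, ← Real.rpow_mul (by norm_num),
      ← Real.rpow_natCast 3 8, ← Real.rpow_mul (by norm_num)]
    rw [show (((8 : ℕ) : ℝ) * (0.87 * ((25 : ℕ) : ℝ))) = ((174 : ℕ) : ℝ) by norm_num]
    rw [Real.rpow_natCast, Real.rpow_natCast]
    norm_num
  calc (2048 : ℝ) ^ k ≤ ((3 ^ 8 : ℝ) ^ (0.87 : ℝ)) ^ k := by gcongr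
    _ = ((3 ^ 8 : ℝ) ^ k) ^ (0.87 : ℝ) := by
      rw [← Real.rpow_natCast, ← Real.rpow_natCast (3 ^ 8 : ℝ) k, ← Real.rpow_mul (by positivity),
        ← Real.rpow_mul (by positivity), mul_comm]
    _ ≤ (3 ^ (8 * k + r) : ℝ) ^ (0.87 : ℝ) := by
      rw [← pow_mul]
      gcongr
      · norm_num
      · omega

theorem exists_exact_automaton_of_pos {d : ℕ} :
    ∃ (M : TwoQCFA Letter) (T : ℕ),
      M.RecognizesExactly (LNE d) ∧ M.RunsInTime T ∧
      (T : ℝ) ≤ 31 * 4 ^ 7 * ((3 ^ d : ℕ) : ℝ) ^ (1.87 : ℝ) ∧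
      (1 ≤ d → M.space ≤ d * Real.logb 2 (4 * 6 * (34 * 4 ^ 7 * 9))) := by
  have hd : 8 * (d / 8) + d % 8 = d := Nat.div_add_mod d 8
  obtain ⟨M, T, h1, h2, hT, hQ, hS⟩ := exists_exact_automaton (d / 8) (d % 8)
  have hpow := two_thousand_forty_eight_pow_le (d / 8) (d % 8)
  rw [hd] at h1 hT hQ hpow
  have h4r : 4 ^ (d % 8) ≤ 4 ^ 7 := Nat.pow_le_pow_right (by norm_num) (by omega)
  have hT' : T ≤ 31 * 4 ^ 7 * 3 ^ d * 2048 ^ (d / 8) := hT.trans (by gcongr)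
  refine ⟨M, T, h1, h2, ?_, fun hd1 => ?_⟩
  · calc (T : ℝ) ≤ 31 * 4 ^ 7 * 3 ^ d * 2048 ^ (d / 8) := by exact_mod_cast hT'
      _ ≤ 31 * 4 ^ 7 * 3 ^ d * (3 ^ d : ℝ) ^ (0.87 : ℝ) := by gcongr
      _ = 31 * 4 ^ 7 * ((3 ^ d : ℕ) : ℝ) ^ (1.87 : ℝ) := by
        rw [show (1.87 : ℝ) = 1 + 0.87 by norm_num, Real.rpow_add (by positivity), Real.rpow_one]
        push_cast
        ring
  · have hSd : Fintype.card M.S ≤ 34 * 4 ^ 7 * 9 ^ d := by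
      have e1 : 2048 ^ (d / 8) ≤ 3 ^ d := calc
        2048 ^ (d / 8) ≤ (3 ^ 8) ^ (d / 8) := by gcongr; norm_num
        _ = 3 ^ (8 * (d / 8)) := by rw [pow_mul]
        _ ≤ 3 ^ d := Nat.pow_le_pow_right (by norm_num) (by omega)
      have e2 : 31 * 4 ^ 7 * 3 ^ d * 2048 ^ (d / 8) ≤ 31 * 4 ^ 7 * 9 ^ d := calc
        _ ≤ 31 * 4 ^ 7 * 3 ^ d * 3 ^ d := by gcongr
        _ = 31 * 4 ^ 7 * 9 ^ d := by rw [mul_assoc, ← mul_pow, show 3 * 3 = 9 by norm_num]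
      have e3 : 0 < 9 ^ d := by positivity
      omega
    have hQ0 : 0 < Fintype.card M.Q := Fintype.card_pos_iff.2 ⟨M.q₀⟩
    have hS0 : 0 < Fintype.card M.S := Fintype.card_pos_iff.2 ⟨M.s₀⟩
    -- For `d ≥ 1` the constant factors are absorbed into the base of the `d`-th power.
    have hprod : Fintype.card M.Q * Fintype.card M.S ≤ (4 * 6 * (34 * 4 ^ 7 * 9)) ^ d := calc
      _ ≤ (4 * 6 ^ d) * (34 * 4 ^ 7 * 9 ^ d) := Nat.mul_le_mul hQ hSd
      _ ≤ (4 ^ d * 6 ^ d) * ((34 * 4 ^ 7) ^ d * 9 ^ d) := by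
        gcongr
        · exact Nat.le_self_pow (by omega) _
        · exact Nat.le_self_pow (by omega) _
      _ = _ := by rw [← mul_pow, ← mul_pow, ← mul_pow]
    rw [TwoQCFA.space, ← Real.logb_mul (by positivity) (by positivity), ← Real.logb_pow]
    refine Real.logb_le_logb_of_le (by norm_num) (by positivity) ?_
    exact_mod_cast hprod

theorem theorem5 :
    ∃ (M : ℕ → TwoQCFA Letter) (T : ℕ → ℕ),
      (∀ d : ℕ, (M d).RecognizesExactly (LNE d) ∧ (M d).RunsInTime (T d)) ∧
      (fun d : ℕ => (T d : ℝ) * (M d).space) =O[atTop]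
        (fun d : ℕ => ((3 ^ d : ℕ) : ℝ) ^ (1.87 : ℝ) * Real.log ((3 ^ d : ℕ) : ℝ)) := by
  choose M T h1 h2 hT hS using @exists_exact_automaton_of_pos
  refine ⟨@M, @T, fun d => ⟨h1, h2⟩, ?_⟩
  set c := Real.logb 2 (4 * 6 * (34 * 4 ^ 7 * 9))
  have hlog : 0 < Real.log 3 := Real.log_pos (by norm_num)
  refine IsBigO.of_bound (31 * 4 ^ 7 * (c / Real.log 3)) ?_
  -- Excluding `d = 0` is needed for the space bound; there `log n = 0`.
  filter_upwards [eventually_ge_atTop 1] with d hd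
  have hspace : 0 ≤ (@M d).space := by
    have hQ0 : 0 < Fintype.card (@M d).Q := Fintype.card_pos_iff.2 ⟨(@M d).q₀⟩
    have hS0 : 0 < Fintype.card (@M d).S := Fintype.card_pos_iff.2 ⟨(@M d).s₀⟩
    exact add_nonneg (Real.logb_nonneg (by norm_num) (by exact_mod_cast hQ0))
      (Real.logb_nonneg (by norm_num) (by exact_mod_cast hS0))
  have hlogd : Real.log ((3 ^ d : ℕ) : ℝ) = d * Real.log 3 := by
    push_cast
    rw [Real.log_pow]
  rw [Real.norm_of_nonneg (by positivity), Real.norm_of_nonneg (by rw [hlogd]; positivity), hlogd]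
  calc (@T d : ℝ) * (@M d).space
      ≤ (31 * 4 ^ 7 * ((3 ^ d : ℕ) : ℝ) ^ (1.87 : ℝ)) * (d * c) :=
        mul_le_mul hT (hS hd) hspace (by positivity)
    _ = _ := by field_simp
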